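/- Let $\mathbb K$ be an algebraically closed field, let $w_1,\dots,w_{n+1}$ be positive integers, let $S=\mathbb K[x_1,\dots,x_{n+1}]$ be graded by $\deg x_i=w_i$, and let $X=P(w_1,\dots,w_{n+1})=\operatorname{Proj} S$ be the weighted projective space. Let $Y\subset X$ be a zero-dimensional (in particular non-empty) closed subscheme, and put $\deg(Y)=\dim_{\mathbb K}\Gamma(Y,\mathcal O_Y)$. Let $I(Y)\subset S$ be a homogeneous ideal defining $Y$, i.e. such that for every homogeneous $f\in S$ of positive degree the ideal of $Y$ on the affine open set $D_+(f)=\operatorname{Spec}\,(S_f)_0$ is $(I(Y)_f)_0$. (For instance $I(Y)$ may be the radical, $\langle x_1,\dots,x_{n+1}\rangle$-saturated homogeneous ideal of $Y$ if $Y$ is reduced.) Write $H_Y(\alpha)=\dim_{\mathbb K}(S/I(Y))_\alpha$ for the Hilbert function of $Y$, and let $$\operatorname{reg}(Y)=\{\alpha\in\mathbb N w_1+\cdots+\mathbb N w_{n+1} : H_Y(\alpha)=\deg(Y)\}\subset\mathbb Z .$$ Suppose that $S/I(Y)$ has a non-zerodivisor which is homogeneous of degree $1$. Then there is an integer $a_Y$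 such that $$\operatorname{reg}(Y)=1+a_Y+\mathbb N .$$ Moreover, the Hilbert series has the form $$\sum_{\alpha\ge 0}H_Y(\alpha)\,t^\alpha=\frac{p_{S/I(Y)}(t)}{(1-t^{w_1})\cdots(1-t^{w_{n+1}})}$$ with a non-zero polynomial $p_{S/I(Y)}\in\mathbb Z[t]$, and $a_Y$ is the degree of this rational function, that is, $$a_Y=\deg(p_{S/I(Y)})-w_1-\cdots-w_{n+1}.$$ -/

import Mathlib

open AlgebraicGeometry CategoryTheory MvPolynomial

noncomputable section

namespace WPS

universe u

variable {K : Type u} [Field K] {n : ℕ} (w : Fin (n + 1) → ℕ)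

variable (K) in
/-- The grading of `S = K[x₀, …, xₙ]` with `deg xᵢ = wᵢ`. -/
abbrev grading (α : ℕ) : Submodule K (MvPolynomial (Fin (n + 1)) K) :=
  weightedHomogeneousSubmodule K w α

instance gradedAlgebra : GradedAlgebra (grading K w) :=
  weightedGradedAlgebra K w

variable (K) in
/-- The weighted projective space `P(w₀, …, wₙ) = Proj S`. -/
abbrev space : Scheme.{u} := Proj (grading K w)

variable (K) in
/-- The structure morphism `P(w₀, …, wₙ) ⟶ Spec S₀ ⟶ Spec K`. -/
def toSpec : space K w ⟶ Spec (CommRingCat.of K) :=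
  Proj.toSpecZero (grading K w) ≫
    Spec.map (CommRingCat.ofHom (algebraMap K (grading K w 0)))

/-- A closed subscheme `Y` of `P(w)` is given by its quasi-coherent sheaf of ideals, `Y.subscheme`
being the scheme itself. This is the ring homomorphism `K → Γ(Y, 𝒪_Y)`. -/
def scalars (Y : (space K w).IdealSheafData) : K →+* Γ(Y.subscheme, ⊤) :=
  ((Scheme.ΓSpecIso (CommRingCat.of K)).inv ≫ (Y.subschemeι ≫ toSpec K w).appTop).hom

/-- `deg(Y) = dim_K Γ(Y, 𝒪_Y)`, for `Y` zero-dimensional. -/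
def degree (Y : (space K w).IdealSheafData) : ℕ :=
  letI : Module K Γ(Y.subscheme, ⊤) := Module.compHom _ (scalars w Y)
  Module.finrank K Γ(Y.subscheme, ⊤)

/-- The degree zero part `(I_f)₀` of the localization of `I` at `f`, an ideal of `(S_f)₀`. -/
def awayIdeal (I : Ideal (MvPolynomial (Fin (n + 1)) K)) (f : MvPolynomial (Fin (n + 1)) K) :
    Ideal (HomogeneousLocalization.Away (grading K w) f) :=
  (I.map (algebraMap (MvPolynomial (Fin (n + 1)) K) (Localization.Away f))).comap
    (algebraMap (HomogeneousLocalization.Away (grading K w) f) (Localization.Away f))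

/-- The ideal `I` of `S` is homogeneous and defines the closed subscheme `Y` of `P(w) = Proj S`:
for each homogeneous `f` of positive degree, the ideal of `Y` on the affine open set `D₊(f)`,
whose coordinate ring is `(S_f)₀`, is `(I_f)₀`. No saturation is asked for, so that this holds both
for the radical `B`-saturated ideal of a reduced `Y` and for the Pic-generated and Pic-saturated
ideal of an arbitrary `Y`, where `B = (x₀, …, xₙ)`. -/
structure Defines (I : Ideal (MvPolynomial (Fin (n + 1)) K))
    (Y : (space K w).IdealSheafData) : Prop where
  isHomogeneous : I.IsHomogeneous (grading K w)
  ideal_eq : ∀ (f : MvPolynomial (Fin (n + 1)) K) (m : ℕ) (hf : f ∈ grading K w m) (hm : 0 < m),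
    (Y.ideal ⟨Proj.basicOpen (grading K w) f,
        Proj.isAffineOpen_basicOpen (grading K w) f hf hm⟩).comap
      (Proj.awayToSection (grading K w) f).hom = awayIdeal w I f

/-- The Hilbert function `H_{S/I}(α) = dim_K (S/I)_α`, where `(S/I)_α` is the image of `S_α`. -/
def hilbertFunction (I : Ideal (MvPolynomial (Fin (n + 1)) K)) (α : ℕ) : ℕ :=
  Module.finrank K ((grading K w α).map (Ideal.Quotient.mkₐ K I).toLinearMap)

/-- The Hilbert series of `S/I`. -/
def hilbertSeries (I : Ideal (MvPolynomial (Fin (n + 1)) K)) : PowerSeries ℤ :=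
  PowerSeries.mk fun α => (hilbertFunction w I α : ℤ)

/-- The denominator `∏ᵢ (1 - t^{wᵢ})` of the Hilbert series. -/
def hilbertDenominator : Polynomial ℤ :=
  ∏ i, (1 - Polynomial.X ^ w i)

/-- `p = p_{S/I}`, that is, `HS_{S/I}(t) = p(t) / ∏ᵢ (1 - t^{wᵢ})`. As `S/I` lives in degrees
`≥ 0`, the Laurent polynomial with this property is a polynomial in `t`. -/
def IsHilbertNumerator (I : Ideal (MvPolynomial (Fin (n + 1)) K)) (p : Polynomial ℤ) : Prop :=
  hilbertSeries w I * (hilbertDenominator w : PowerSeries ℤ) = (p : PowerSeries ℤ)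

/-- The rational function `p(t) / ∏ᵢ (1 - t^{wᵢ})`. -/
def ratio (p : Polynomial ℤ) : RatFunc ℚ :=
  algebraMap (Polynomial ℚ) (RatFunc ℚ) (p.map (Int.castRingHom ℚ)) /
    algebraMap (Polynomial ℚ) (RatFunc ℚ) ((hilbertDenominator w).map (Int.castRingHom ℚ))

/-- `reg(Y)`, computed with the ideal `I` of `Y`: the set of degrees `α` in the semigroup `ℕβ`
generated by the weights, inside the class group `ℤ`, such that `H_{S/I}(α) = deg(Y)`. -/
def regularity (I : Ideal (MvPolynomial (Fin (n + 1)) K)) (Y : (space K w).IdealSheafData) :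
    Set ℤ :=
  {b | ∃ α ∈ AddSubmonoid.closure (Set.range w), b = (α : ℤ) ∧ hilbertFunction w I α = degree w Y}

end WPS

end

/-!
Let `F` be the homogeneous nonzerodivisor of degree one on `S/I`. The point is that `Y` lies in the
affine open set `D₊(F)`, and that on it `S/I` becomes a filtration of the coordinate ring of `Y`.

Since `Y` is zero-dimensional, for every homogeneous `f` of positive degree the coordinate ring of
`Y ∩ D₊(f)` is a zero-dimensional ring, and `F ^ deg f / f` is a nonzerodivisor in it, hence a
unit. So `F` vanishes nowhere on `Y` (`WPS.Defines.preimage_basicOpen_eq_top`), and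
`Γ(Y, 𝒪_Y) = (S_F)₀ / (I_F)₀`. This is a finitely generated zero-dimensional `K`-algebra, so it is
finite-dimensional (`WPS.finite_of_krullDimLE_zero`).

As `F` has degree one, `s ↦ s / F ^ α` maps `S_α` to `Γ(Y, 𝒪_Y)`, with kernel `S_α ∩ I`. The images
are subspaces of dimension `H_Y(α)` which increase with `α` and exhaust `Γ(Y, 𝒪_Y)`. Hence `H_Y` is
nondecreasing, bounded by `deg Y`, and equal to `deg Y` from some least `N` on
(`WPS.Defines.hilbertFunction_mono_and_stable`).

The generating function of such a sequence is `q(t) / (1 - t)` with `deg q = N`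
(`WPS.exists_numerator`), so its degree as a rational function is `a = N - 1`. A nonzero form of
degree one exists only if some weight is `1`; therefore the semigroup of the weights is `ℕ`, whence
`reg(Y) = N + ℕ`, and `1 - t` divides `∏ᵢ (1 - t ^ wᵢ)`, so that the Hilbert series can be written
over this denominator.
-/

/-! ### Zero-dimensional rings and schemes, and sections on `D₊(f)` -/

lemma Ring.KrullDimLE.isUnit_of_mem_nonZeroDivisors {R : Type*} [CommRing R]
    [Ring.KrullDimLE 0 R] {r : R} (hr : r ∈ nonZeroDivisors R) : IsUnit r := by
  by_contra h
  obtain ⟨M, hM, hrM⟩ := exists_max_ideal_of_mem_nonunits h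
  have := hM.isPrime
  have := Ideal.disjoint_nonZeroDivisors_of_mem_minimalPrimes
    (Ideal.mem_minimalPrimes_of_krullDimLE_zero M)
  exact Set.disjoint_left.mp this hrM hr

namespace AlgebraicGeometry

universe u

lemma krullDimLE_zero_of_isAffineOpen {X : Scheme.{u}} (hX : topologicalKrullDim X ≤ 0)
    {U : X.Opens} (hU : IsAffineOpen U) : Ring.KrullDimLE 0 Γ(X, U) := by
  rw [Ring.KrullDimLE, Order.krullDimLE_iff, ← ringKrullDim, Nat.cast_zero,
    ← PrimeSpectrum.topologicalKrullDim_eq_ringKrullDim Γ(X, U)]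
  change topologicalKrullDim (Spec Γ(X, U)) ≤ 0
  rw [← IsHomeomorph.topologicalKrullDim_eq _ hU.isoSpec.hom.homeomorph.isHomeomorph]
  exact (topologicalKrullDim_subspace_le X U).trans hX

open HomogeneousLocalization in
/-- The section `g ^ m / f ^ d` of `𝒪(D₊(f))` is invertible only on `D₊(g)`. -/
lemma Proj.basicOpen_awayToSection_le {σ : Type*} {A : Type u} [CommRing A] [SetLike σ A]
    [AddSubgroupClass σ A] (𝒜 : ℕ → σ) [GradedRing 𝒜] {f g : A} {m d : ℕ} (hf : f ∈ 𝒜 m)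
    (hm : 0 < m) (hg : g ∈ 𝒜 d) :
    (Proj 𝒜).basicOpen ((Proj.awayToSection 𝒜 f).hom (Away.isLocalizationElem hf hg)) ≤
      Proj.basicOpen 𝒜 g := by
  intro x hx
  have hxf : x ∈ Proj.basicOpen 𝒜 f := (Proj 𝒜).basicOpen_le _ hx
  rw [Scheme.mem_basicOpen _ _ _ hxf] at hx
  have h := ConcreteCategory.congr_hom (ProjectiveSpectrum.Proj.awayToSection_germ 𝒜 f x hxf)
    (Away.isLocalizationElem hf hg)
  have hx' : IsUnit ((AlgebraicGeometry.Proj.stalkIso' 𝒜 x).symm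
    (mapId 𝒜 (Submonoid.powers_le.mpr hxf) (Away.isLocalizationElem hf hg))) :=
    h ▸ hx
  rw [MulEquiv.isUnit_map] at hx'
  rw [← isUnit_iff_isUnit_val] at hx'
  let y : ProjectiveSpectrum 𝒜 := x
  have : y.asHomogeneousIdeal.toIdeal.IsPrime := y.isPrime
  have hfy : f ^ d ∈ y.asHomogeneousIdeal.toIdeal.primeCompl :=
    fun h ↦ hxf (this.mem_of_pow_mem _ h)
  have e : (mapId 𝒜 (Submonoid.powers_le.mpr hxf) (Away.isLocalizationElem hf hg)).val =
      (Localization.mk (g ^ m) ⟨f ^ d, hfy⟩ :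
        Localization y.asHomogeneousIdeal.toIdeal.primeCompl) := rfl
  rw [e, Localization.mk_eq_mk', IsLocalization.AtPrime.isUnit_mk'_iff] at hx'
  exact fun h ↦ hx' (Ideal.pow_mem_of_mem _ h _ hm)

/-- On `D₊(f)` the structure map `Proj A ⟶ Spec A₀` is given by `A₀ → (A_f)₀`. -/
lemma Proj.toSpecZero_appTop_restrict {σ : Type*} {A : Type u} [CommRing A] [SetLike σ A]
    [AddSubgroupClass σ A] (𝒜 : ℕ → σ) [GradedRing 𝒜] {f : A} {m : ℕ} (hf : f ∈ 𝒜 m)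
    (hm : 0 < m) :
    (Scheme.ΓSpecIso (CommRingCat.of (𝒜 0))).inv ≫ (Proj.toSpecZero 𝒜).appTop ≫
      (Proj 𝒜).presheaf.map (homOfLE (le_top : Proj.basicOpen 𝒜 f ≤ ⊤)).op =
    CommRingCat.ofHom (HomogeneousLocalization.fromZeroRingHom 𝒜 _) ≫
      Proj.awayToSection 𝒜 f := by
  have h : (Proj.basicOpen 𝒜 f).ι ≫ Proj.toSpecZero 𝒜 = Proj.basicOpenToSpec 𝒜 f ≫
      Spec.map (CommRingCat.ofHom (HomogeneousLocalization.fromZeroRingHom 𝒜 _)) := by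
    rw [← Proj.awayι_toSpecZero 𝒜 f hf hm, Proj.awayι, ← Proj.basicOpenIsoSpec_hom 𝒜 f hf hm]
    simp
  have h2 := congr_arg (fun φ => (Scheme.ΓSpecIso (CommRingCat.of (𝒜 0))).inv ≫
    Scheme.Hom.appTop φ ≫ (Proj.basicOpen 𝒜 f).topIso.hom) h
  have h3 : (Proj.basicOpenToSpec 𝒜 f).appTop = _ := Proj.basicOpenToSpec_app_top 𝒜 f
  simp only [Scheme.Hom.comp_appTop] at h2
  have h4 : Scheme.Hom.appTop (Proj.basicOpen 𝒜 f).ι ≫ (Proj.basicOpen 𝒜 f).topIso.hom =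
      (Proj 𝒜).presheaf.map (homOfLE (le_top : Proj.basicOpen 𝒜 f ≤ ⊤)).op :=
    ((Proj 𝒜).presheaf.map_comp _ _).symm
  rw [Category.assoc, h4] at h2
  rw [h2, h3, Category.assoc, ← Scheme.ΓSpecIso_inv_naturality_assoc, Category.assoc, Category.assoc,
    Iso.inv_hom_id, Category.comp_id, Iso.inv_hom_id_assoc]

end AlgebraicGeometry

/-! ### The coordinate rings of `Y` on the open sets `D₊(f)` -/

namespace WPS

universe u

variable {K : Type u} [Field K] {n : ℕ} {w : Fin (n + 1) → ℕ}

open HomogeneousLocalization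

/-- A fraction `s / f ^ k` lies in `(I_f)₀` iff a power of `f` multiplies `s` into `I`. -/
lemma mk_mem_awayIdeal {I : Ideal (MvPolynomial (Fin (n + 1)) K)}
    {f : MvPolynomial (Fin (n + 1)) K} {m : ℕ} (hf : f ∈ grading K w m) (k : ℕ)
    {s : MvPolynomial (Fin (n + 1)) K} (hs : s ∈ grading K w (k • m)) :
    Away.mk (grading K w) hf k s hs ∈ awayIdeal w I f ↔ ∃ N, f ^ N * s ∈ I := by
  rw [awayIdeal, Ideal.mem_comap, HomogeneousLocalization.algebraMap_apply,
    Away.val_mk, Localization.mk_eq_mk', IsLocalization.mk'_mem_map_algebraMap_iff]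
  simp [Submonoid.mem_powers_iff]

/-- If `F` is a nonzerodivisor modulo `I`, then `I` is saturated with respect to `F`. -/
lemma mem_of_pow_mul_mem {R : Type*} [CommRing R] {I : Ideal R} {F : R}
    (hF : Ideal.Quotient.mk I F ∈ nonZeroDivisors (R ⧸ I)) (k : ℕ) {s : R}
    (h : F ^ k * s ∈ I) : s ∈ I := by
  rw [← Ideal.Quotient.eq_zero_iff_mem] at h ⊢
  rw [map_mul, map_pow, mul_comm] at h
  exact (mul_right_mem_nonZeroDivisors_eq_zero_iff (pow_mem hF k)).mp h

section Sections

variable (Y : (space K w).IdealSheafData)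

/-- The ring homomorphism `(S_f)₀ → Γ(Y ∩ D₊(f), 𝒪_Y)`. -/
noncomputable def awayToSubscheme (f : MvPolynomial (Fin (n + 1)) K) :
    Away (grading K w) f →+*
      Γ(Y.subscheme, Y.subschemeι ⁻¹ᵁ Proj.basicOpen (grading K w) f) :=
  (Y.subschemeι.app (Proj.basicOpen (grading K w) f)).hom.comp
    (Proj.awayToSection (grading K w) f).hom

lemma awayToSubscheme_surjective {f : MvPolynomial (Fin (n + 1)) K} {m : ℕ}
    (hf : f ∈ grading K w m) (hm : 0 < m) :
    Function.Surjective (awayToSubscheme Y f) :=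
  (Y.subschemeι_app_surjective ⟨_, Proj.isAffineOpen_basicOpen (grading K w) f hf hm⟩).comp
    (Proj.basicOpenIsoAway (grading K w) f hf hm).commRingCatIsoToRingEquiv.surjective

variable {Y} in
lemma Defines.ker_awayToSubscheme {I : Ideal (MvPolynomial (Fin (n + 1)) K)}
    (hI : Defines w I Y) {f : MvPolynomial (Fin (n + 1)) K} {m : ℕ}
    (hf : f ∈ grading K w m) (hm : 0 < m) :
    RingHom.ker (awayToSubscheme Y f) = awayIdeal w I f := by
  rw [← hI.ideal_eq f m hf hm, ← Y.ker_subschemeι_app]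
  rfl

variable {Y} {I : Ideal (MvPolynomial (Fin (n + 1)) K)}

lemma Defines.awayToSubscheme_mk_eq_zero (hI : Defines w I Y)
    {f : MvPolynomial (Fin (n + 1)) K} {m : ℕ}
    (hf : f ∈ grading K w m) (hm : 0 < m) (k : ℕ) {s : MvPolynomial (Fin (n + 1)) K}
    (hs : s ∈ grading K w (k • m)) :
    awayToSubscheme Y f (Away.mk (grading K w) hf k s hs) = 0 ↔ ∃ N, f ^ N * s ∈ I := by
  rw [← RingHom.mem_ker, hI.ker_awayToSubscheme hf hm, mk_mem_awayIdeal]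

lemma krullDimLE_zero_sections (hY : topologicalKrullDim Y.subscheme = 0)
    {f : MvPolynomial (Fin (n + 1)) K} {m : ℕ} (hf : f ∈ grading K w m) (hm : 0 < m) :
    Ring.KrullDimLE 0 Γ(Y.subscheme, Y.subschemeι ⁻¹ᵁ Proj.basicOpen (grading K w) f) :=
  krullDimLE_zero_of_isAffineOpen hY.le
    ((Proj.isAffineOpen_basicOpen (grading K w) f hf hm).preimage Y.subschemeι)

/-- A homogeneous `F` that is a nonzerodivisor modulo `I` vanishes nowhere on `Y`: on `D₊(f)` the
function `F ^ deg f / f ^ deg F` is a nonzerodivisor of a zero-dimensional ring, hence a unit. -/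
lemma Defines.preimage_basicOpen_eq_top (hI : Defines w I Y)
    (hY : topologicalKrullDim Y.subscheme = 0) {F : MvPolynomial (Fin (n + 1)) K} {d : ℕ}
    (hF : F ∈ grading K w d)
    (hF' : Ideal.Quotient.mk I F ∈ nonZeroDivisors (MvPolynomial (Fin (n + 1)) K ⧸ I)) :
    Y.subschemeι ⁻¹ᵁ Proj.basicOpen (grading K w) F = ⊤ := by
  rw [eq_top_iff]
  intro y _
  -- The image of `y` is a relevant prime, so it misses some homogeneous `f` of positive degree.
  obtain ⟨f, m, hm, hf, hy⟩ : ∃ f m, 0 < m ∧ f ∈ grading K w m ∧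
      Y.subschemeι y ∈ Proj.basicOpen (grading K w) f := by
    classical
    by_contra! H
    refine (show ProjectiveSpectrum (grading K w) from Y.subschemeι y).not_irrelevant_le ?_
    intro s hs
    rw [HomogeneousIdeal.mem_irrelevant_iff] at hs
    rw [← DirectSum.sum_support_decompose (grading K w) s]
    refine sum_mem fun i _ ↦ ?_
    rcases Nat.eq_zero_or_pos i with rfl | hi
    · rw [← GradedRing.proj_apply, hs]
      exact zero_mem _
    · have := H _ i hi (SetLike.coe_mem (DirectSum.decompose (grading K w) s i))
      rw [Proj.mem_basicOpen, not_not] at this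
      exact this
  have := krullDimLE_zero_sections hY hf hm
  set g := awayToSubscheme Y f (Away.isLocalizationElem hf hF) with hg
  have hg0 : g ∈ nonZeroDivisors _ := by
    rw [mem_nonZeroDivisors_iff_right]
    intro x hx
    obtain ⟨x, rfl⟩ := awayToSubscheme_surjective Y hf hm x
    obtain ⟨k, a, ha, rfl⟩ := Away.mk_surjective (grading K w) hf x
    have hprod : Away.mk (grading K w) hf k a ha * Away.isLocalizationElem hf hF =
        Away.mk (grading K w) hf (k + d) (a * F ^ m) (by
          rw [add_smul]
          refine SetLike.mul_mem_graded ha ?_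
          rw [smul_eq_mul, mul_comm]
          exact SetLike.pow_mem_graded _ hF) := by
      ext
      simp [Away.isLocalizationElem, Away.val_mk, Localization.mk_mul, pow_add]
    rw [hg, ← map_mul, hprod, hI.awayToSubscheme_mk_eq_zero hf hm] at hx
    obtain ⟨N, hN⟩ := hx
    rw [hI.awayToSubscheme_mk_eq_zero hf hm]
    exact ⟨N, mem_of_pow_mul_mem hF' m (by convert hN using 1; ring)⟩
  have hu : IsUnit g := Ring.KrullDimLE.isUnit_of_mem_nonZeroDivisors hg0
  have hb : Y.subscheme.basicOpen g = _ := Y.subscheme.basicOpen_of_isUnit hu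
  have hb' : Y.subscheme.basicOpen g = Y.subschemeι ⁻¹ᵁ (space K w).basicOpen
    ((Proj.awayToSection (grading K w) f).hom (Away.isLocalizationElem hf hF)) :=
    (Scheme.preimage_basicOpen _ _).symm
  exact Proj.basicOpen_awayToSection_le (grading K w) hf hm hF (hb'.le (hb.ge hy))

end Sections

/-! ### The filtration of the functions on `Y` by degree -/

lemma mem_grading_smul_one {α : ℕ} {s : MvPolynomial (Fin (n + 1)) K} (hs : s ∈ grading K w α) :
    s ∈ grading K w (α • 1) := by
  rwa [smul_eq_mul, mul_one]

/-- The structure map `K → S₀ → (S_f)₀`. -/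
noncomputable def scalarsAway (w : Fin (n + 1) → ℕ) (f : MvPolynomial (Fin (n + 1)) K) :
    K →+* Away (grading K w) f :=
  (fromZeroRingHom (grading K w) _).comp (algebraMap K (grading K w 0))

lemma algebraMap_gradeZero_surjective (hw : ∀ i, 0 < w i) :
    Function.Surjective (algebraMap K (grading K w 0)) := by
  rintro ⟨s, hs⟩
  refine ⟨coeff 0 s, Subtype.ext ?_⟩
  change C (coeff 0 s) = s
  rw [← weightedHomogeneousComponent_zero (w := w) s fun i ↦ (hw i).ne',
    weightedHomogeneousComponent_of_mem hs, if_pos rfl]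

lemma finiteType_scalarsAway (hw : ∀ i, 0 < w i) {f : MvPolynomial (Fin (n + 1)) K} {m : ℕ}
    (hf : f ∈ grading K w m) : (scalarsAway w f).FiniteType := by
  have : IsScalarTower K (grading K w 0) (MvPolynomial (Fin (n + 1)) K) :=
    ⟨fun a b c ↦ smul_mul_assoc a b.1 c⟩
  have : Algebra.FiniteType (grading K w 0) (MvPolynomial (Fin (n + 1)) K) :=
    Algebra.FiniteType.of_restrictScalars_finiteType K _ _
  exact RingHom.FiniteType.comp (g := fromZeroRingHom (grading K w) (Submonoid.powers f))
    (Away.finiteType f m hf) (.of_surjective _ (algebraMap_gradeZero_surjective hw))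

section Filtration

variable {F : MvPolynomial (Fin (n + 1)) K} (hF : F ∈ grading K w 1)
  {G : Type*} [CommRing G] [Algebra K G] (ψ : Away (grading K w) F →+* G)
  (hψ : ψ.comp (scalarsAway w F) = algebraMap K G)

/-- For `F` of degree one, the linear map `S_α → G`, `s ↦ ψ (s / F ^ α)`, where `G` is a
`K`-algebra under `(S_F)₀`. -/
noncomputable def divPow (α : ℕ) : grading K w α →ₗ[K] G where
  toFun s := ψ (Away.mk (grading K w) hF α s (mem_grading_smul_one s.2))
  map_add' s t := by
    rw [← map_add]
    congr 1
    ext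
    simp [Away.val_mk, Localization.add_mk_self]
  map_smul' c s := by
    rw [RingHom.id_apply, Algebra.smul_def, ← hψ, RingHom.comp_apply, ← map_mul]
    congr 1
    ext
    rw [val_mul, Away.val_mk, Away.val_mk]
    change _ = Localization.mk (C c) 1 * _
    rw [Localization.mk_mul, one_mul, Submodule.coe_smul, C_mul']

/-- The ranges of the maps `s ↦ s / F ^ α` increase with `α`, as `s / F ^ α = s F / F ^ (α + 1)`. -/
lemma range_divPow_mono : Monotone fun α ↦ LinearMap.range (divPow hF ψ hψ α) := by
  refine monotone_nat_of_le_succ fun α ↦ ?_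
  rintro _ ⟨s, rfl⟩
  refine ⟨⟨s.1 * F, SetLike.mul_mem_graded s.2 hF⟩, ?_⟩
  change ψ _ = ψ _
  congr 1
  ext
  rw [Away.val_mk, Away.val_mk, Localization.mk_eq_mk_iff, Localization.r_iff_exists]
  exact ⟨1, by simp; ring⟩

lemma exists_mem_range_divPow (hs : Function.Surjective ψ) (g : G) :
    ∃ α, g ∈ LinearMap.range (divPow hF ψ hψ α) := by
  obtain ⟨x, rfl⟩ := hs g
  obtain ⟨k, a, ha, rfl⟩ := Away.mk_surjective (grading K w) hF x
  exact ⟨k, ⟨a, by rwa [smul_eq_mul, mul_one] at ha⟩, rfl⟩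

/-- If the kernel of `(S_F)₀ → G` contains `s / F ^ α` exactly when `s ∈ I`, then `(S/I)_α` and the
range of `s ↦ s / F ^ α` are both the quotient of `S_α` by `S_α ∩ I`. -/
lemma hilbertFunction_eq_finrank_range {I : Ideal (MvPolynomial (Fin (n + 1)) K)}
    (hI : ∀ α s (hs : s ∈ grading K w (α • 1)),
      ψ (Away.mk (grading K w) hF α s hs) = 0 ↔ s ∈ I) (α : ℕ) :
    hilbertFunction w I α = Module.finrank K (LinearMap.range (divPow hF ψ hψ α)) := by
  set q := (Ideal.Quotient.mkₐ K I).toLinearMap ∘ₗ (grading K w α).subtype with hq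
  have hker : LinearMap.ker q = LinearMap.ker (divPow hF ψ hψ α) := by
    ext s
    rw [LinearMap.mem_ker, LinearMap.mem_ker]
    exact Ideal.Quotient.eq_zero_iff_mem.trans (hI α s _).symm
  have hr : (grading K w α).map (Ideal.Quotient.mkₐ K I).toLinearMap = LinearMap.range q := by
    rw [hq, LinearMap.range_comp, Submodule.range_subtype]
  rw [hilbertFunction, hr]
  exact (q.quotKerEquivRange.symm ≪≫ₗ Submodule.quotEquivOfEq _ _ hker ≪≫ₗ
    (divPow hF ψ hψ α).quotKerEquivRange).finrank_eq

include hψ in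
/-- A zero-dimensional quotient of `(S_F)₀` is finite-dimensional, as `(S_F)₀` is a finitely
generated `K`-algebra. -/
lemma finite_of_krullDimLE_zero (hw : ∀ i, 0 < w i) (hF : F ∈ grading K w 1)
    (hs : Function.Surjective ψ)
    [Ring.KrullDimLE 0 G] : Module.Finite K G := by
  have : Algebra.FiniteType K G := by
    rw [← RingHom.finiteType_algebraMap, ← hψ]
    exact (RingHom.FiniteType.of_surjective ψ hs).comp (finiteType_scalarsAway hw hF)
  exact (Module.finite_iff_krullDimLE_zero K G).mpr inferInstance

end Filtration

/-! ### The degree of `Y` -/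

section Degree

variable (Y : (space K w).IdealSheafData)

/-- The structure map of `Y` restricts to `K → (S_f)₀ → Γ(Y ∩ D₊(f), 𝒪_Y)` over `D₊(f)`. -/
lemma awayToSubscheme_comp_scalarsAway {f : MvPolynomial (Fin (n + 1)) K} {m : ℕ}
    (hf : f ∈ grading K w m) (hm : 0 < m) :
    (awayToSubscheme Y f).comp (scalarsAway w f) =
      (Y.subscheme.presheaf.map (homOfLE (le_top :
        Y.subschemeι ⁻¹ᵁ Proj.basicOpen (grading K w) f ≤ ⊤)).op).hom.comp (scalars w Y) := by
  have h := Proj.toSpecZero_appTop_restrict (grading K w) hf hm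
  have h1 : (Y.subschemeι ≫ toSpec K w).appTop = (toSpec K w).appTop ≫ Y.subschemeι.appTop :=
    Scheme.Hom.comp_appTop _ _
  have h2 : (toSpec K w).appTop = (Spec.map (CommRingCat.ofHom
    (algebraMap K (grading K w 0)))).appTop ≫ (Proj.toSpecZero (grading K w)).appTop :=
    Scheme.Hom.comp_appTop _ _
  have h3 : Y.subschemeι.appTop ≫ Y.subscheme.presheaf.map (homOfLE (le_top :
        Y.subschemeι ⁻¹ᵁ Proj.basicOpen (grading K w) f ≤ ⊤)).op =
      (space K w).presheaf.map (homOfLE (le_top : Proj.basicOpen (grading K w) f ≤ ⊤)).op ≫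
        Y.subschemeι.app (Proj.basicOpen (grading K w) f) :=
    (Y.subschemeι.naturality _).symm
  have key : (Scheme.ΓSpecIso (CommRingCat.of K)).inv ≫ (Y.subschemeι ≫ toSpec K w).appTop ≫
      Y.subscheme.presheaf.map (homOfLE (le_top :
        Y.subschemeι ⁻¹ᵁ Proj.basicOpen (grading K w) f ≤ ⊤)).op =
      CommRingCat.ofHom (algebraMap K (grading K w 0)) ≫
        CommRingCat.ofHom (fromZeroRingHom (grading K w) (Submonoid.powers f)) ≫
        Proj.awayToSection (grading K w) f ≫
        Y.subschemeι.app (Proj.basicOpen (grading K w) f) := by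
    rw [h1, h2, Category.assoc, Category.assoc, h3, ← reassoc_of% h,
      ← Scheme.ΓSpecIso_inv_naturality_assoc]
  exact (congr_arg CommRingCat.Hom.hom key).symm

/-- If `Y` lies in `D₊(f)`, then `deg Y` is the dimension of the coordinate ring of `Y ∩ D₊(f)`. -/
lemma degree_eq_finrank {f : MvPolynomial (Fin (n + 1)) K} {m : ℕ}
    (hf : f ∈ grading K w m) (hm : 0 < m)
    (htop : Y.subschemeι ⁻¹ᵁ Proj.basicOpen (grading K w) f = ⊤) :
    let := ((awayToSubscheme Y f).comp (scalarsAway w f)).toAlgebra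
    degree w Y =
      Module.finrank K Γ(Y.subscheme, Y.subschemeι ⁻¹ᵁ Proj.basicOpen (grading K w) f) := by
  let := ((awayToSubscheme Y f).comp (scalarsAway w f)).toAlgebra
  let : Module K Γ(Y.subscheme, ⊤) := Module.compHom _ (scalars w Y)
  have hiso : IsIso (homOfLE (le_top :
        Y.subschemeι ⁻¹ᵁ Proj.basicOpen (grading K w) f ≤ ⊤)) :=
    ⟨homOfLE htop.ge, Subsingleton.elim _ _, Subsingleton.elim _ _⟩
  let r := Y.subscheme.presheaf.map (homOfLE (le_top :
        Y.subschemeι ⁻¹ᵁ Proj.basicOpen (grading K w) f ≤ ⊤)).op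
  have hr : IsIso r := inferInstance
  let e := (asIso r).commRingCatIsoToRingEquiv
  refine LinearEquiv.finrank_eq { e with map_smul' := fun c x ↦ ?_ }
  change e (scalars w Y c * x) = ((awayToSubscheme Y f).comp (scalarsAway w f)) c * e x
  rw [map_mul, awayToSubscheme_comp_scalarsAway Y hf hm]
  rfl

end Degree

/-! ### The Hilbert function of `S/I` -/

section HilbertFunction

variable {I : Ideal (MvPolynomial (Fin (n + 1)) K)} {Y : (space K w).IdealSheafData}

/-- The Hilbert function counts the dimensions of the exhaustive filtration of the
finite-dimensional algebra `Γ(Y, 𝒪_Y)` by the subspaces `{s / F ^ α | s ∈ S_α}`. -/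
lemma Defines.hilbertFunction_mono_and_stable (hw : ∀ i, 0 < w i) (hI : Defines w I Y)
    (hY : topologicalKrullDim Y.subscheme = 0) {F : MvPolynomial (Fin (n + 1)) K}
    (hF : F ∈ grading K w 1)
    (hF' : Ideal.Quotient.mk I F ∈ nonZeroDivisors (MvPolynomial (Fin (n + 1)) K ⧸ I)) :
    Monotone (hilbertFunction w I) ∧ (∀ α, hilbertFunction w I α ≤ degree w Y) ∧
      (∃ α, hilbertFunction w I α = degree w Y) ∧ 0 < degree w Y := by
  have htop := hI.preimage_basicOpen_eq_top hY hF hF'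
  have := krullDimLE_zero_sections hY hF one_pos
  set ψ := awayToSubscheme Y F
  have hs : Function.Surjective ψ := awayToSubscheme_surjective Y hF one_pos
  have hdeg := degree_eq_finrank Y hF one_pos htop
  let := (ψ.comp (scalarsAway w F)).toAlgebra
  have hψ : ψ.comp (scalarsAway w F) = algebraMap K _ := rfl
  have hfin := finite_of_krullDimLE_zero ψ hψ hw hF hs
  have hH := hilbertFunction_eq_finrank_range hF ψ hψ (I := I) fun α s hs ↦ by
    rw [hI.awayToSubscheme_mk_eq_zero hF one_pos]
    exact ⟨fun ⟨N, h⟩ ↦ mem_of_pow_mul_mem hF' N h, fun h ↦ ⟨0, by simpa using h⟩⟩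
  have hmono := range_divPow_mono hF ψ hψ
  refine ⟨fun α β h ↦ ?_, fun α ↦ ?_, ?_, ?_⟩
  · rw [hH, hH]
    exact Submodule.finrank_mono (hmono h)
  · rw [hH, hdeg]
    exact Submodule.finrank_le _
  · obtain ⟨N, hN⟩ := monotone_stabilizes_iff_noetherian.mpr
      (inferInstance : IsNoetherian K Γ(Y.subscheme, _)) ⟨_, hmono⟩
    refine ⟨N, ?_⟩
    have hNtop : LinearMap.range (divPow hF ψ hψ N) = ⊤ := by
      refine eq_top_iff.mpr fun g _ ↦ ?_
      obtain ⟨k, hk⟩ := exists_mem_range_divPow hF ψ hψ hs g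
      exact (hN (max k N) (le_max_right _ _)).ge (hmono (le_max_left k N) hk)
    rw [hH, hdeg, hNtop, finrank_top]
  · have : Nonempty Y.subscheme := by
      by_contra h
      have := not_nonempty_iff.mp h
      have : IsEmpty (TopologicalSpace.IrreducibleCloseds Y.subscheme) :=
        ⟨fun c ↦ isEmptyElim c.isIrreducible'.nonempty.some⟩
      have : topologicalKrullDim Y.subscheme = ⊥ := Order.krullDim_eq_bot
      rw [this] at hY
      exact WithBot.bot_ne_zero hY
    have : Nontrivial Γ(Y.subscheme, Y.subschemeι ⁻¹ᵁ Proj.basicOpen (grading K w) F) := by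
      have : Nonempty (⊤ : Y.subscheme.Opens) := ⟨⟨this.some, trivial⟩⟩
      rw [htop]
      infer_instance
    rw [hdeg]
    exact Module.finrank_pos

/-- A nonzero form of degree one has a monomial of weight one, whose only variable has weight
one. -/
lemma exists_weight_eq_one {F : MvPolynomial (Fin (n + 1)) K} (hF : F ∈ grading K w 1)
    (hF0 : F ≠ 0) : ∃ i, w i = 1 := by
  obtain ⟨d, hd⟩ := MvPolynomial.ne_zero_iff.mp hF0
  have h := (mem_weightedHomogeneousSubmodule K w 1 F).mp hF hd
  rw [Finsupp.weight_apply, Finsupp.sum] at h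
  obtain ⟨i, hi, hi0⟩ := Finset.exists_ne_zero_of_sum_ne_zero (h.trans_ne one_ne_zero)
  have hle : d i * w i ≤ 1 :=
    (Finset.single_le_sum (f := fun i ↦ d i • w i) (fun _ _ ↦ Nat.zero_le _) hi).trans_eq h
  have h1 : d i * w i = 1 := hle.antisymm (Nat.one_le_iff_ne_zero.mpr hi0)
  exact ⟨i, Nat.eq_one_of_mul_eq_one_left h1⟩

end HilbertFunction

/-! ### Hilbert series as rational functions -/

section Series

open PowerSeries in
/-- A sequence that takes a value `d ≠ 0` exactly from `N` on has a generating function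
`q / (1 - t)` with `deg q = N`: the last nonzero difference of the sequence is the one at `N`. -/
lemma exists_numerator {h : ℕ → ℤ} {d : ℤ} {N : ℕ} (hd : d ≠ 0) (hN : ∀ k, N ≤ k → h k = d)
    (hlt : ∀ k, k < N → h k ≠ d) :
    ∃ q : Polynomial ℤ, q ≠ 0 ∧ q.natDegree = N ∧
      PowerSeries.mk h * ((1 - Polynomial.X : Polynomial ℤ) : PowerSeries ℤ) = q := by
  set P := PowerSeries.mk h * ((1 - Polynomial.X : Polynomial ℤ) : PowerSeries ℤ) with hP
  have hP' : P = PowerSeries.mk h - PowerSeries.mk h * PowerSeries.X := by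
    rw [hP]; push_cast; ring
  have h0 : coeff 0 P = h 0 := by
    rw [hP']; simp
  have hsucc (k : ℕ) : coeff (k + 1) P = h (k + 1) - h k := by
    rw [hP', map_sub, coeff_succ_mul_X, coeff_mk, coeff_mk]
  have hzero (k : ℕ) (hk : N < k) : coeff k P = 0 := by
    obtain ⟨k, rfl⟩ := Nat.exists_eq_add_one_of_ne_zero (Nat.ne_zero_of_lt hk)
    rw [hsucc, hN _ (by omega), hN _ (by omega), sub_self]
  have hne : coeff N P ≠ 0 := by
    rcases N with _ | N
    · rwa [h0, hN 0 le_rfl]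
    · rw [hsucc, hN _ le_rfl, sub_ne_zero]
      exact (hlt N N.lt_succ_self).symm
  have hq : (trunc (N + 1) P).coeff N ≠ 0 := by
    rwa [coeff_trunc, if_pos N.lt_succ_self]
  refine ⟨trunc (N + 1) P, fun h ↦ hq (by rw [h, Polynomial.coeff_zero]), ?_, ?_⟩
  · exact Polynomial.natDegree_eq_of_le_of_coeff_ne_zero
      (Nat.le_of_lt_succ (natDegree_trunc_lt P N)) hq
  · ext k
    rw [Polynomial.coeff_coe, coeff_trunc]
    split_ifs with hk
    · rfl
    · exact hzero k (by omega)

lemma natDegree_one_sub_X_pow (k : ℕ) :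
    (1 - Polynomial.X ^ k : Polynomial ℤ).natDegree = k := by
  rw [← neg_sub, Polynomial.natDegree_neg, ← Polynomial.C_1, Polynomial.natDegree_X_pow_sub_C]

lemma one_sub_X_pow_ne_zero {k : ℕ} (hk : 0 < k) : (1 - Polynomial.X ^ k : Polynomial ℤ) ≠ 0 := by
  intro h
  have := natDegree_one_sub_X_pow k
  rw [h, Polynomial.natDegree_zero] at this
  omega

lemma hilbertDenominator_ne_zero (hw : ∀ i, 0 < w i) : hilbertDenominator w ≠ 0 :=
  Finset.prod_ne_zero_iff.mpr fun i _ ↦ one_sub_X_pow_ne_zero (hw i)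

lemma natDegree_hilbertDenominator (hw : ∀ i, 0 < w i) :
    (hilbertDenominator w).natDegree = ∑ i, w i := by
  rw [hilbertDenominator, Polynomial.natDegree_prod _ _ fun i _ ↦ one_sub_X_pow_ne_zero (hw i)]
  exact Finset.sum_congr rfl fun i _ ↦ natDegree_one_sub_X_pow _

/-- The degree of a quotient of polynomials does not depend on whether it is in lowest terms. -/
lemma intDegree_ratio (hw : ∀ i, 0 < w i) {p : Polynomial ℤ} (hp : p ≠ 0) :
    (ratio w p).intDegree = p.natDegree - ∑ i, (w i : ℤ) := by
  have hinj : Function.Injective (Int.castRingHom ℚ) := Int.cast_injective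
  have hne {q : Polynomial ℤ} (hq : q ≠ 0) :
      algebraMap (Polynomial ℚ) (RatFunc ℚ) (q.map (Int.castRingHom ℚ)) ≠ 0 := by
    rw [Ne, map_eq_zero_iff _ (RatFunc.algebraMap_injective ℚ)]
    exact (Polynomial.map_ne_zero_iff hinj).mpr hq
  rw [ratio, RatFunc.intDegree_div (hne hp) (hne (hilbertDenominator_ne_zero hw)),
    RatFunc.intDegree_polynomial, RatFunc.intDegree_polynomial,
    Polynomial.natDegree_map_eq_of_injective hinj, Polynomial.natDegree_map_eq_of_injective hinj,
    natDegree_hilbertDenominator hw, Nat.cast_sum]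

end Series

end WPS

theorem mainTheorem9 {K : Type*} [Field K] [IsAlgClosed K] {n : ℕ} (w : Fin (n + 1) → ℕ)
    (hw : ∀ i, 0 < w i) (Y : (WPS.space K w).IdealSheafData)
    (hY : topologicalKrullDim Y.subscheme = 0)
    (I : Ideal (MvPolynomial (Fin (n + 1)) K)) (hI : WPS.Defines w I Y)
    (hF : ∃ F ∈ WPS.grading K w 1,
      Ideal.Quotient.mk I F ∈ nonZeroDivisors (MvPolynomial (Fin (n + 1)) K ⧸ I)) :
    ∃ a : ℤ, WPS.regularity w I Y = {b | ∃ k : ℕ, b = 1 + a + k} ∧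
      ∃ p : Polynomial ℤ, p ≠ 0 ∧ WPS.IsHilbertNumerator w I p ∧
        (WPS.ratio w p).intDegree = a ∧ a = (p.natDegree : ℤ) - ∑ i, (w i : ℤ) := by
  obtain ⟨F, hF, hF'⟩ := hF
  obtain ⟨hmono, hle, hex, hpos⟩ := hI.hilbertFunction_mono_and_stable hw hY hF hF'
  -- `F = 0` would give `I = S` and a vanishing Hilbert function, whereas `deg Y > 0`.
  have hF0 : F ≠ 0 := by
    rintro rfl
    rw [map_zero] at hF'
    obtain ⟨α, hα⟩ := hex
    have : Subsingleton (MvPolynomial (Fin (n + 1)) K ⧸ I) := subsingleton_of_zero_eq_one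
      ((mul_right_mem_nonZeroDivisors_eq_zero_iff hF').mp (mul_zero 1)).symm
    have : WPS.hilbertFunction w I α = 0 := Module.finrank_zero_of_subsingleton
    omega
  obtain ⟨i₀, hi₀⟩ := WPS.exists_weight_eq_one hF hF0
  classical
  -- The Hilbert function attains `deg Y` exactly from `N` on, which forces `a = N - 1`.
  set N := Nat.find hex
  have hstable (k : ℕ) (hk : N ≤ k) : WPS.hilbertFunction w I k = WPS.degree w Y :=
    (hle k).antisymm ((Nat.find_spec hex).ge.trans (hmono hk))
  obtain ⟨q, hq0, hqN, hq⟩ := WPS.exists_numerator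
    (h := fun α ↦ (WPS.hilbertFunction w I α : ℤ)) (d := WPS.degree w Y) (N := N)
    (by exact_mod_cast hpos.ne') (fun k hk ↦ by rw [hstable k hk])
    (fun k hk h ↦ Nat.find_min hex hk (by exact_mod_cast h))
  -- One factor of the denominator `∏ᵢ (1 - t ^ wᵢ)` is `1 - t`; the others are collected in `E`.
  set E : Polynomial ℤ := ∏ i ∈ Finset.univ.erase i₀, (1 - Polynomial.X ^ w i)
  have hD : WPS.hilbertDenominator w = (1 - Polynomial.X) * E := by
    rw [WPS.hilbertDenominator, ← Finset.mul_prod_erase _ _ (Finset.mem_univ i₀), hi₀, pow_one]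
  have hE0 : E ≠ 0 := right_ne_zero_of_mul (hD ▸ WPS.hilbertDenominator_ne_zero hw)
  have hdegE : 1 + E.natDegree = ∑ i, w i := by
    rw [← WPS.natDegree_hilbertDenominator hw, hD, Polynomial.natDegree_mul
      (left_ne_zero_of_mul (hD ▸ WPS.hilbertDenominator_ne_zero hw)) hE0]
    congr 1
    simpa using (WPS.natDegree_one_sub_X_pow 1).symm
  have hp0 : q * E ≠ 0 := mul_ne_zero hq0 hE0
  have hdeg : ((q * E).natDegree : ℤ) - ∑ i, (w i : ℤ) = N - 1 := by
    rw [Polynomial.natDegree_mul hq0 hE0, hqN, ← Nat.cast_sum, ← hdegE]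
    push_cast
    ring
  refine ⟨N - 1, ?_, q * E, hp0, ?_, (WPS.intDegree_ratio hw hp0).trans hdeg, hdeg.symm⟩
  · ext b
    constructor
    · rintro ⟨α, -, rfl, hα⟩
      exact ⟨α - N, by have := Nat.find_min' hex hα; omega⟩
    · rintro ⟨k, rfl⟩
      refine ⟨N + k, ?_, by push_cast; ring, hstable _ (Nat.le_add_right _ _)⟩
      -- The semigroup of the weights is all of `ℕ`, since `1` is a weight.
      have h1 : 1 ∈ AddSubmonoid.closure (Set.range w) :=
        AddSubmonoid.subset_closure ⟨i₀, hi₀⟩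
      simpa using nsmul_mem h1 (N + k)
  · rw [WPS.IsHilbertNumerator, hD, Polynomial.coe_mul, ← mul_assoc, Polynomial.coe_mul]
    exact congr_arg (· * (E : PowerSeries ℤ)) hq
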